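/- Let $n,N_{\rm G}\ge 0$ be integers, let $S_a$, $a\in\{0,1,2,3\}^n$, be the $n$-qubit Pauli operators ($S_0=I$), and represent operators $A$ and Hermiticity-preserving maps $\mathcal O$ by the vectors $\frac{1}{\sqrt{2^n}}{\rm tr}(S_aA)$ and the Pauli transfer matrices $\frac{1}{2^n}{\rm tr}(S_a\mathcal O(S_b))$. Let $\mathcal M_{\rm ob}$ be a Hermitian observable with eigenvalues in $[-1,1]$ and vector $v_{\rm ob}$. Let $U_1,\dots,U_{N_{\rm G}}$ be unitary gates with Pauli transfer matrices $G_k$, and let gate $k$ be followed by a Pauli channel $\rho\mapsto\sum_a \pi_{k}(a)\,S_a\rho S_a^\dagger$ ($\pi_k$ a probability vector) with Pauli transfer matrix $C_k={\rm diag}(c_k)$, $c_k=\widetilde H\pi_k$, where $\widetilde H_{ab}=1$ if $S_a,S_b$ commute and $-1$ otherwise. Assume that for some $\epsilon_{\rm u}<\frac12$ every gate error probability satisfies $$1-4^{-n}\,{\rm tr}(C_k)\le\epsilon_{\rm u}.$$ Let $\alpha_k=4^{-n}\widetilde H(1/c_k)$ (entrywise reciprocal) be the quasi-probability vector of $C_k^{-1}$.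 Let $N_{\rm s}>0$ be real, and for each $k$ let $N_k\ge N_{\rm s}\|\alpha_k\|_1^2$ be an integer (in particular $N_k=N_{\rm s}\|\alpha_k\|_1^2$ when this is an integer). Draw, independently over all gates and samples, $N_k$ labels for gate $k$ from the distribution $|\alpha_k|/\|\alpha_k\|_1$, let $\widetilde p_k(a)$ be the empirical frequency of $a$, and let $$\Gamma_k=\|\alpha_k\|_1\sum_a {\rm sgn}(\alpha_k(a))\,\widetilde p_k(a)\,O_a,$$ where $O_a$ is the Pauli transfer matrix of $\rho\mapsto S_a\rho S_a^\dagger$. Let $v_0$ be the vector of $|0\rangle\langle 0|^{\otimes n}$, $v_k=\Gamma_kC_kG_kv_{k-1}$, and let $r=v_{\rm ob}^{\rm T}v_{N_{\rm G}}$ be the computational result of the circuit protected by Monte Carlo-based quantum error mitigation; let $\widetilde r=\langle 0|^{\otimes n}U_1^\dagger\cdots U_{N_{\rm G}}^\dagger\mathcal M_{\rm ob}U_{N_{\rm G}}\cdots U_1|0\rangle^{\otimes n}$ be the decoherence-free result. Then $(r-\widetilde r)^2$ is integrable and $$\sqrt{\mathbb E\{(r-\widetilde r)^2\}}\le 2^{n/2}\sqrt{\exp\left(\tilde\epsilon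 N_{\rm G}N_{\rm s}^{-1}\right)-1},$$ where $$\tilde\epsilon=\tfrac52\sigma_{\rm u}+\tfrac14\sigma_{\rm u}^2,\qquad \sigma_{\rm u}=4\epsilon_{\rm u}\,\frac{1-\epsilon_{\rm u}}{(1-2\epsilon_{\rm u})^2}.$$ Moreover, regarding $\tilde\epsilon$ as a function of $\epsilon_{\rm u}$, we have $\tilde\epsilon\sim10\epsilon_{\rm u}$ as $\epsilon_{\rm u}\to0$, and, for fixed $n,N_{\rm G},N_{\rm s}$, the bound is asymptotically equivalent to $2^{n/2}\sqrt{\exp(10\epsilon_{\rm u}N_{\rm G}N_{\rm s}^{-1})-1}$ as $\epsilon_{\rm u}\to0^+$. -/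

import Mathlib

open MeasureTheory ProbabilityTheory Filter Topology Asymptotics

noncomputable section

namespace PauliQEM

/-- Labels of the `4 ^ n` Pauli operators on `n` qubits; on each qubit `0, 1, 2, 3` stand for
`I, X, Y, Z`. The label `0` is the identity operator. -/
abbrev PauliIdx (n : ℕ) : Type := Fin n → Fin 4

/-- Operators on the `2 ^ n`-dimensional Hilbert space of `n` qubits, in the computational basis;
the basis label `0` is the all-zero state. -/
abbrev Op (n : ℕ) : Type := Matrix (Fin n → Fin 2) (Fin n → Fin 2) ℂ

/-- The one-qubit Pauli matrices `I, X, Y, Z`. -/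
def pauliMatrix : Fin 4 → Matrix (Fin 2) (Fin 2) ℂ :=
  ![1, !![0, 1; 1, 0], !![0, -Complex.I; Complex.I, 0], !![1, 0; 0, -1]]

/-- The `n`-qubit Pauli operator `S_a`, the tensor product of one-qubit Pauli matrices. -/
def pauliOp {n : ℕ} (a : PauliIdx n) : Op n :=
  Matrix.of fun x y => ∏ i, pauliMatrix (a i) (x i) (y i)

/-- Pauli transfer matrix of an operator map `O`: the entries `2 ^ (-n) tr (S_a O(S_b))`.
It is applied only to maps preserving Hermiticity, for which these traces are real. -/
def ptm {n : ℕ} (O : Op n → Op n) : Matrix (PauliIdx n) (PauliIdx n) ℝ :=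
  Matrix.of fun a b => (1 / 2 ^ n : ℝ) * (pauliOp a * O (pauliOp b)).trace.re

/-- Vector representation of a Hermitian operator `A`: the entries `2 ^ (-n/2) tr (S_a A)`. -/
def ptmVec {n : ℕ} (A : Op n) : PauliIdx n → ℝ :=
  fun a => (1 / √(2 ^ n) : ℝ) * (pauliOp a * A).trace.re

/-- The map `ρ ↦ V ρ Vᴴ`. -/
def conjBy {n : ℕ} (V : Op n) (ρ : Op n) : Op n := V * ρ * V.conjTranspose

/-- The Pauli channel `ρ ↦ ∑ a, p a • S_a ρ S_aᴴ`. -/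
def pauliChannel {n : ℕ} (p : PauliIdx n → ℝ) (ρ : Op n) : Op n :=
  ∑ a, (p a : ℂ) • conjBy (pauliOp a) ρ

/-- `p` is a probability vector. -/
def IsProbVec {ι : Type*} [Fintype ι] (p : ι → ℝ) : Prop := (∀ a, 0 ≤ p a) ∧ ∑ a, p a = 1

/-- Gate error probability `1 - 4 ^ (-n) tr C` of a channel with Pauli transfer matrix `C`. -/
def gateErrorProb {n : ℕ} (C : Matrix (PauliIdx n) (PauliIdx n) ℝ) : ℝ :=
  1 - 1 / 4 ^ n * C.trace

/-- The Hadamard transform over `n` qubits, in the Pauli labelling: the entry at `(a, b)` is `1` if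
`S_a` and `S_b` commute and `-1` if they anticommute. -/
def hadamard (n : ℕ) : Matrix (PauliIdx n) (PauliIdx n) ℝ :=
  Matrix.of fun a b => ∏ i, if a i = 0 ∨ b i = 0 ∨ a i = b i then 1 else -1

/-- The diagonal `c = H p` of the Pauli transfer matrix of the Pauli channel `p`. -/
def channelDiag {n : ℕ} (p : PauliIdx n → ℝ) : PauliIdx n → ℝ := (hadamard n).mulVec p

/-- The quasi-probability representation vector `α = H⁻¹ (1 / c)` of the inverse of the Pauli
channel `p`, where `H⁻¹ = 4 ^ (-n) H`. -/
def quasiProb {n : ℕ} (p : PauliIdx n → ℝ) : PauliIdx n → ℝ :=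
  (1 / 4 ^ n : ℝ) • (hadamard n).mulVec fun a => 1 / channelDiag p a

/-- The `ℓ¹` norm `‖α‖₁` of the quasi-probability representation vector. -/
def quasiProbNorm {n : ℕ} (p : PauliIdx n → ℝ) : ℝ := ∑ a, |quasiProb p a|

/-- The distribution `|α_a| / ‖α‖₁` from which the Monte Carlo implementation samples. -/
def samplingProb {n : ℕ} (p : PauliIdx n → ℝ) (a : PauliIdx n) : ℝ :=
  |quasiProb p a| / quasiProbNorm p

/-- The empirical frequency of `a` among the samples `l 0, …, l (N - 1)`. -/
def empiricalFreq {n : ℕ} (N : ℕ) (l : ℕ → PauliIdx n) (a : PauliIdx n) : ℝ :=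
  1 / N * ∑ i ∈ Finset.range N, if l i = a then 1 else 0

/-- The approximate inverse channel (as a Pauli transfer matrix) obtained from the samples
`l 0, …, l (N - 1)`: the sum over `a` of `‖α‖₁ sgn(α_a)` times the empirical frequency of `a`
times the Pauli transfer matrix of `ρ ↦ S_a ρ S_aᴴ`. -/
def approxInverse {n : ℕ} (p : PauliIdx n → ℝ) (N : ℕ) (l : ℕ → PauliIdx n) :
    Matrix (PauliIdx n) (PauliIdx n) ℝ :=
  ∑ a, (quasiProbNorm p * Real.sign (quasiProb p a) * empiricalFreq N l a) •
    ptm (conjBy (pauliOp a))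

/-- The residual channel: the noise channel followed by its approximate inverse. -/
def residualChannel {n : ℕ} (p : PauliIdx n → ℝ) (N : ℕ) (l : ℕ → PauliIdx n) :
    Matrix (PauliIdx n) (PauliIdx n) ℝ :=
  approxInverse p N l * ptm (pauliChannel p)

/-- The input state `|0…0⟩⟨0…0|`. -/
def initialState (n : ℕ) : Op n := Matrix.single 0 0 1

/-- The product `U_{k-1} ⋯ U_0` of the first `k` gates. -/
def idealCircuit {n : ℕ} (U : ℕ → Op n) : ℕ → Op n
  | 0 => 1
  | k + 1 => U k * idealCircuit U k

/-- The decoherence-free result `⟨0…0| Vᴴ M V |0…0⟩`, where `V` is the product of the first `NG`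
gates. -/
def idealResult {n : ℕ} (M : Op n) (U : ℕ → Op n) (NG : ℕ) : ℝ :=
  ((idealCircuit U NG).conjTranspose * M * idealCircuit U NG) 0 0 |>.re

/-- The vector `v_k` describing the state after `k` protected gates. Gate `k` is the unitary `U k`
followed by the residual channel of the Pauli channel `p k`, inverted approximately by the samples
`l k 0, …, l k (N k - 1)`. -/
def mitigatedState {n : ℕ} (U : ℕ → Op n) (p : ℕ → PauliIdx n → ℝ) (N : ℕ → ℕ)
    (l : ℕ → ℕ → PauliIdx n) : ℕ → PauliIdx n → ℝ
  | 0 => ptmVec (initialState n)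
  | k + 1 => (residualChannel (p k) (N k) (l k) * ptm (conjBy (U k))).mulVec
      (mitigatedState U p N l k)

/-- The result of the protected circuit with `NG` gates, for given samples `l`. -/
def mitigatedResult {n : ℕ} (M : Op n) (U : ℕ → Op n) (p : ℕ → PauliIdx n → ℝ) (N : ℕ → ℕ)
    (l : ℕ → ℕ → PauliIdx n) (NG : ℕ) : ℝ :=
  ptmVec M ⬝ᵥ mitigatedState U p N l NG

/-- `σ = 4 ε (1 - ε) / (1 - 2 ε)²`. -/
def sigmaU (ε : ℝ) : ℝ := 4 * ε * ((1 - ε) / (1 - 2 * ε) ^ 2)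

/-- `(5 / 2) σ + (1 / 4) σ²`. -/
def epsTilde (ε : ℝ) : ℝ := 5 / 2 * sigmaU ε + 1 / 4 * sigmaU ε ^ 2

/-- `2 ^ (n / 2) √(exp (e NG / Ns) - 1)`. -/
def rmseBound (n NG : ℕ) (Ns e : ℝ) : ℝ :=
  (2 : ℝ) ^ ((n : ℝ) / 2) * √(Real.exp (e * NG / Ns) - 1)

end PauliQEM

end

namespace PauliQEM

-- In the Pauli basis each residual channel is a random diagonal matrix, and each gate is an
-- orthogonal matrix (`sum_sq_ptm_conjBy_mulVec`). The diagonal entries have mean exactly 1, because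
-- importance sampling of the quasi-probability vector α is unbiased. Their second moment is at most
-- 1 + s whenever (‖α_k‖₁² - 1) / N_k ≤ s for every gate (`integral_sq_residualDiag_le`).
--
-- The samples of a gate are independent of the state reaching it. Hence the mean of the state
-- vector is the ideal vector, while its expected squared norm grows by at most a factor 1 + s per
-- gate (`integral_mitigatedState`, `integral_sum_sq_mitigatedState_le`). The ideal vector has norm
-- 1, so the expected squared deviation is at most (1 + s)^NG - 1. Cauchy–Schwarz against the
-- observable, whose squared norm is tr M² ≤ 2^n, bounds the error of the result.
--
-- The cost ‖α‖₁ is controlled by the fact that α is the convolution inverse of p on the group of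
-- Pauli labels. Since p has mass at least 1 - ε > 1/2 at the identity, ‖α‖₁ ≤ 1 / (1 - 2ε)
-- (`IsProbVec.quasiProbNorm_mul_le`), which is ‖α‖₁² - 1 ≤ σ. Finally (1 + s)^NG ≤ exp (s NG) with
-- s = σ / Ns, and σ ≤ ε̃.

/-- The tensor product of one-qubit matrices. -/
def tensorOp {n : ℕ} (A : Fin n → Matrix (Fin 2) (Fin 2) ℂ) : Op n :=
  Matrix.of fun x y => ∏ i, A i (x i) (y i)

lemma pauliOp_eq_tensorOp {n : ℕ} (a : PauliIdx n) :
    pauliOp a = tensorOp fun i => pauliMatrix (a i) := rfl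

lemma tensorOp_mul {n : ℕ} (A B : Fin n → Matrix (Fin 2) (Fin 2) ℂ) :
    tensorOp A * tensorOp B = tensorOp fun i => A i * B i := by
  ext x y
  simp only [tensorOp, Matrix.mul_apply, Matrix.of_apply, ← Finset.prod_mul_distrib]
  rw [Finset.prod_univ_sum, Fintype.piFinset_univ]

lemma tensorOp_conjTranspose {n : ℕ} (A : Fin n → Matrix (Fin 2) (Fin 2) ℂ) :
    (tensorOp A).conjTranspose = tensorOp fun i => (A i).conjTranspose := by
  ext x y
  simp [tensorOp, Matrix.conjTranspose_apply]

lemma trace_tensorOp {n : ℕ} (A : Fin n → Matrix (Fin 2) (Fin 2) ℂ) :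
    (tensorOp A).trace = ∏ i, (A i).trace := by
  simp only [tensorOp, Matrix.trace, Matrix.diag, Matrix.of_apply]
  rw [Finset.prod_univ_sum, Fintype.piFinset_univ]

lemma tensorOp_smul {n : ℕ} (s : Fin n → ℂ) (A : Fin n → Matrix (Fin 2) (Fin 2) ℂ) :
    tensorOp (fun i => s i • A i) = (∏ i, s i) • tensorOp A := by
  ext x y
  simp [tensorOp, Finset.prod_mul_distrib]

/-- The commutation sign of two one-qubit Pauli labels. -/
def pauliSign (a b : Fin 4) : ℤ := if a = 0 ∨ b = 0 ∨ a = b then 1 else -1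

lemma hadamard_apply {n : ℕ} (a b : PauliIdx n) :
    hadamard n a b = ∏ i, (pauliSign (a i) (b i) : ℝ) := by
  simp only [hadamard, Matrix.of_apply, pauliSign]
  push_cast
  rfl

lemma pauliMatrix_conjTranspose (a : Fin 4) :
    (pauliMatrix a).conjTranspose = pauliMatrix a := by
  ext i j
  fin_cases a <;> fin_cases i <;> fin_cases j <;> simp [pauliMatrix]

lemma pauliMatrix_conj (a b : Fin 4) :
    pauliMatrix a * pauliMatrix b * pauliMatrix a = (pauliSign a b : ℂ) • pauliMatrix b := by
  ext i j
  fin_cases a <;> fin_cases b <;> fin_cases i <;> fin_cases j <;>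
    simp [pauliMatrix, pauliSign, Matrix.mul_apply, Fin.sum_univ_two]

lemma pauliMatrix_trace_mul (a b : Fin 4) :
    (pauliMatrix a * pauliMatrix b).trace = if a = b then 2 else 0 := by
  fin_cases a <;> fin_cases b <;>
    simp [pauliMatrix, Fin.sum_univ_two, Matrix.trace] <;> norm_num

lemma pauliMatrix_complete (x y z w : Fin 2) :
    ∑ a, pauliMatrix a x y * pauliMatrix a z w = if x = w ∧ y = z then 2 else 0 := by
  fin_cases x <;> fin_cases y <;> fin_cases z <;> fin_cases w <;>
    simp [pauliMatrix, Fin.sum_univ_four] <;> norm_num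

/-! ### Pauli operators as an orthogonal operator basis. -/

lemma isHermitian_pauliOp {n : ℕ} (a : PauliIdx n) : (pauliOp a).IsHermitian := by
  simp only [Matrix.IsHermitian, pauliOp_eq_tensorOp, tensorOp_conjTranspose,
    pauliMatrix_conjTranspose]

lemma conjBy_pauliOp {n : ℕ} (a b : PauliIdx n) :
    conjBy (pauliOp a) (pauliOp b) = (hadamard n a b : ℂ) • pauliOp b := by
  rw [conjBy, (isHermitian_pauliOp a).eq]
  simp only [pauliOp_eq_tensorOp, tensorOp_mul, pauliMatrix_conj, tensorOp_smul, hadamard_apply]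
  push_cast
  rfl

lemma trace_pauliOp_mul {n : ℕ} (a b : PauliIdx n) :
    (pauliOp a * pauliOp b).trace = if a = b then 2 ^ n else 0 := by
  simp only [pauliOp_eq_tensorOp, tensorOp_mul, trace_tensorOp, pauliMatrix_trace_mul]
  split_ifs with h
  · simp [h]
  · obtain ⟨i, hi⟩ := Function.ne_iff.1 h
    exact Finset.prod_eq_zero (Finset.mem_univ i) (if_neg hi)

/-- The sum of S_a ⊗ S_a is 2^n times the swap operator; this factors over the qubits and is the
completeness relation behind the trace identities. -/
lemma sum_pauliOp_mul_pauliOp {n : ℕ} (x y z w : Fin n → Fin 2) :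
    ∑ a, pauliOp a x y * pauliOp a z w = if x = w ∧ y = z then (2 : ℂ) ^ n else 0 := by
  have h : ∑ a : PauliIdx n, pauliOp a x y * pauliOp a z w
      = ∏ i, ∑ a, pauliMatrix a (x i) (y i) * pauliMatrix a (z i) (w i) := by
    rw [Finset.prod_univ_sum, Fintype.piFinset_univ]
    simp [pauliOp, Finset.prod_mul_distrib]
  rw [h]
  simp only [pauliMatrix_complete]
  split_ifs with h
  · simp [h]
  · have : ∃ i, ¬ (x i = w i ∧ y i = z i) := by
      by_contra! hc
      exact h ⟨funext fun i => (hc i).1, funext fun i => (hc i).2⟩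
    obtain ⟨i, hi⟩ := this
    exact Finset.prod_eq_zero (Finset.mem_univ i) (if_neg hi)

/-- The Pauli operators form an orthogonal basis. -/
lemma sum_trace_mul_trace {n : ℕ} (A B : Op n) :
    ∑ a, (pauliOp a * A).trace * (pauliOp a * B).trace = 2 ^ n * (A * B).trace := by
  have h : ∀ a : PauliIdx n, (pauliOp a * A).trace * (pauliOp a * B).trace
      = ∑ x, ∑ y, ∑ z, ∑ w, A y x * B w z * (pauliOp a x y * pauliOp a z w) := by
    intro a
    rw [mul_comm]
    simp only [Matrix.trace, Matrix.diag, Matrix.mul_apply]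
    simp only [Finset.sum_mul, Finset.mul_sum]
    refine Finset.sum_congr rfl fun x _ => Finset.sum_congr rfl fun y _ =>
      Finset.sum_congr rfl fun z _ => Finset.sum_congr rfl fun w _ => by ring
  simp only [h]
  rw [Finset.sum_comm]
  have h2 : ∀ x : Fin n → Fin 2, ∑ a : PauliIdx n, ∑ y, ∑ z, ∑ w,
      A y x * B w z * (pauliOp a x y * pauliOp a z w) = ∑ y, 2 ^ n * (A y x * B x y) := by
    intro x
    rw [Finset.sum_comm]
    refine Finset.sum_congr rfl fun y _ => ?_
    rw [Finset.sum_comm]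
    have h3 : ∀ z, ∑ a : PauliIdx n, ∑ w, A y x * B w z * (pauliOp a x y * pauliOp a z w)
        = if y = z then 2 ^ n * (A y x * B x z) else 0 := by
      intro z
      rw [Finset.sum_comm]
      simp only [← Finset.mul_sum, sum_pauliOp_mul_pauliOp]
      split_ifs with hz
      · simp [hz, mul_comm]
      · simp [hz]
    simp [h3]
  simp only [h2, ← Finset.mul_sum]
  rw [Finset.sum_comm]
  rfl

lemma trace_mul_im_eq_zero {n : ℕ} {A B : Op n} (hA : A.IsHermitian) (hB : B.IsHermitian) :
    (A * B).trace.im = 0 := by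
  have h : star (A * B).trace = (A * B).trace := by
    rw [← Matrix.trace_conjTranspose, Matrix.conjTranspose_mul, hA.eq, hB.eq, Matrix.trace_mul_comm]
  exact Complex.conj_eq_iff_im.1 h

/-- One Hermitian factor suffices: tr(S_a A) is then real, so taking real parts commutes with the
product. -/
lemma sum_re_trace_mul_re_trace {n : ℕ} {A : Op n} (hA : A.IsHermitian) (B : Op n) :
    ∑ a, (pauliOp a * A).trace.re * (pauliOp a * B).trace.re = 2 ^ n * (A * B).trace.re := by
  have h := congrArg Complex.re (sum_trace_mul_trace A B)
  have h2 : ((2 : ℂ) ^ n) = ((2 ^ n : ℝ) : ℂ) := by push_cast; rfl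
  rw [Complex.re_sum, h2, Complex.re_ofReal_mul] at h
  rw [← h]
  refine Finset.sum_congr rfl fun a _ => ?_
  rw [Complex.mul_re, trace_mul_im_eq_zero (isHermitian_pauliOp a) hA]
  ring

/-! ### Vectors and transfer matrices in the Pauli basis. -/

lemma ptmVec_dotProduct_ptmVec {n : ℕ} {A : Op n} (hA : A.IsHermitian) (B : Op n) :
    ptmVec A ⬝ᵥ ptmVec B = (A * B).trace.re := by
  have h : ptmVec A ⬝ᵥ ptmVec B
      = (1 / √(2 ^ n)) ^ 2 * ∑ a, (pauliOp a * A).trace.re * (pauliOp a * B).trace.re := by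
    rw [Finset.mul_sum]
    exact Finset.sum_congr rfl fun a _ => by simp only [ptmVec]; ring
  rw [h, sum_re_trace_mul_re_trace hA B, div_pow, Real.sq_sqrt (by positivity)]
  field_simp

lemma isHermitian_conjBy {n : ℕ} (V : Op n) {A : Op n} (hA : A.IsHermitian) :
    (conjBy V A).IsHermitian := by
  simp [conjBy, Matrix.IsHermitian, Matrix.conjTranspose_mul, hA.eq, Matrix.mul_assoc]

lemma trace_mul_conjBy {n : ℕ} (V A B : Op n) :
    (A * conjBy V B).trace = (B * conjBy V.conjTranspose A).trace := by
  rw [conjBy, conjBy, Matrix.conjTranspose_conjTranspose, Matrix.trace_mul_comm,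
    Matrix.mul_assoc, Matrix.mul_assoc, Matrix.trace_mul_comm]
  simp only [Matrix.mul_assoc]

lemma ptm_conjBy_mulVec_ptmVec {n : ℕ} (V A : Op n) :
    (ptm (conjBy V)).mulVec (ptmVec A) = ptmVec (conjBy V A) := by
  ext a
  have h : (ptm (conjBy V)).mulVec (ptmVec A) a = 1 / 2 ^ n * (1 / √(2 ^ n)) *
      ∑ b, (pauliOp b * conjBy V.conjTranspose (pauliOp a)).trace.re
        * (pauliOp b * A).trace.re := by
    rw [Finset.mul_sum]
    refine Finset.sum_congr rfl fun b _ => ?_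
    simp only [ptm, ptmVec, Matrix.of_apply, trace_mul_conjBy V]
    ring
  rw [h, sum_re_trace_mul_re_trace (isHermitian_conjBy _ (isHermitian_pauliOp a)), ptmVec,
    trace_mul_conjBy, Matrix.trace_mul_comm]
  field_simp

/-- Conjugation by a unitary preserves the trace inner product, for which the Pauli operators are
orthogonal. -/
lemma ptm_conjBy_transpose_mul_self {n : ℕ} {V : Op n}
    (hV : V ∈ Matrix.unitaryGroup (Fin n → Fin 2) ℂ) :
    (ptm (conjBy V)).transpose * ptm (conjBy V) = 1 := by
  have hV' : V.conjTranspose * V = 1 := Matrix.mem_unitaryGroup_iff'.1 hV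
  ext b c
  have h : ((ptm (conjBy V)).transpose * ptm (conjBy V)) b c = (1 / 2 ^ n) ^ 2 *
      ∑ a, (pauliOp a * conjBy V (pauliOp b)).trace.re
        * (pauliOp a * conjBy V (pauliOp c)).trace.re := by
    rw [Matrix.mul_apply, Finset.mul_sum]
    refine Finset.sum_congr rfl fun b _ => ?_
    simp only [ptm, Matrix.transpose_apply, Matrix.of_apply]
    ring
  have h2 : conjBy V.conjTranspose (conjBy V (pauliOp b)) = pauliOp b := by
    simp only [conjBy, Matrix.conjTranspose_conjTranspose, Matrix.mul_assoc, hV', Matrix.mul_one]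
    rw [← Matrix.mul_assoc, hV', Matrix.one_mul]
  rw [h, sum_re_trace_mul_re_trace (isHermitian_conjBy _ (isHermitian_pauliOp b)),
    trace_mul_conjBy, h2, trace_pauliOp_mul,
    Matrix.one_apply]
  by_cases hbc : b = c
  · have h3 : ((2 : ℂ) ^ n) = ((2 ^ n : ℝ) : ℂ) := by push_cast; rfl
    rw [if_pos hbc.symm, if_pos hbc, h3, Complex.ofReal_re]
    field_simp
  · rw [if_neg hbc, if_neg (Ne.symm hbc)]
    simp

lemma sum_sq_ptm_conjBy_mulVec {n : ℕ} {V : Op n}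
    (hV : V ∈ Matrix.unitaryGroup (Fin n → Fin 2) ℂ) (v : PauliIdx n → ℝ) :
    ∑ a, (ptm (conjBy V)).mulVec v a ^ 2 = ∑ a, v a ^ 2 := by
  have h : (ptm (conjBy V)).mulVec v ⬝ᵥ (ptm (conjBy V)).mulVec v = v ⬝ᵥ v := by
    rw [Matrix.dotProduct_mulVec, Matrix.vecMul_mulVec,
      ptm_conjBy_transpose_mul_self hV, Matrix.vecMul_one]
  simpa only [dotProduct, ← sq] using h

/-! ### Pauli channels -/

lemma ptm_conjBy_pauliOp {n : ℕ} (a : PauliIdx n) :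
    ptm (conjBy (pauliOp a)) = Matrix.diagonal (hadamard n a) := by
  ext b c
  rw [ptm, Matrix.of_apply, conjBy_pauliOp, Matrix.mul_smul, Matrix.trace_smul, smul_eq_mul,
    Complex.re_ofReal_mul, trace_pauliOp_mul, Matrix.diagonal_apply]
  have h3 : ((2 : ℂ) ^ n) = ((2 ^ n : ℝ) : ℂ) := by push_cast; rfl
  split_ifs with h
  · rw [h3, Complex.ofReal_re, h]
    field_simp
  · simp

lemma hadamard_symm {n : ℕ} (a b : PauliIdx n) : hadamard n a b = hadamard n b a := by
  have h : ∀ a b : Fin 4, pauliSign a b = pauliSign b a := by decide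
  simp only [hadamard_apply, h]

lemma ptm_pauliChannel {n : ℕ} (p : PauliIdx n → ℝ) :
    ptm (pauliChannel p) = Matrix.diagonal (channelDiag p) := by
  have h : ptm (pauliChannel p) = ∑ a, p a • ptm (conjBy (pauliOp a)) := by
    ext b c
    simp only [ptm, pauliChannel, Matrix.sum_apply, Matrix.smul_apply, Matrix.of_apply,
      Matrix.trace_sum, Complex.re_sum, Finset.mul_sum, Matrix.mul_smul,
      Matrix.trace_smul, smul_eq_mul, Complex.re_ofReal_mul]
    exact Finset.sum_congr rfl fun a _ => by ring
  rw [h]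
  ext b c
  simp only [ptm_conjBy_pauliOp, Matrix.sum_apply, Matrix.smul_apply, Matrix.diagonal_apply,
    smul_eq_mul, channelDiag, Matrix.mulVec, dotProduct]
  split_ifs
  · exact Finset.sum_congr rfl fun a _ => by rw [hadamard_symm b, mul_comm]
  · simp

lemma hadamard_zero {n : ℕ} (a : PauliIdx n) : hadamard n a 0 = 1 := by
  simp [hadamard_apply, pauliSign]

lemma abs_hadamard {n : ℕ} (a b : PauliIdx n) : |hadamard n a b| = 1 := by
  rw [hadamard_apply, Finset.abs_prod]
  refine Finset.prod_eq_one fun i _ => ?_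
  rw [pauliSign]
  split_ifs <;> simp

lemma sum_hadamard {n : ℕ} (a : PauliIdx n) :
    ∑ b, hadamard n a b = if a = 0 then 4 ^ n else 0 := by
  have h1 : ∀ a : Fin 4, ∑ b, pauliSign a b = if a = 0 then 4 else 0 := by decide
  have h : ∑ b, hadamard n a b = ((∏ i, ∑ b, pauliSign (a i) b : ℤ) : ℝ) := by
    rw [Finset.prod_univ_sum, Fintype.piFinset_univ]
    push_cast
    simp only [hadamard_apply]
  rw [h]
  simp only [h1]
  split_ifs with h
  · simp [h]
  · obtain ⟨i, hi⟩ := Function.ne_iff.1 h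
    rw [Finset.prod_eq_zero (Finset.mem_univ i) (if_neg hi), Int.cast_zero]

/-- The label of the product of two Pauli operators. -/
def labelMul {n : ℕ} (a b : PauliIdx n) : PauliIdx n := fun i => a i ^^^ b i

lemma labelMul_labelMul {n : ℕ} (a b : PauliIdx n) : labelMul (labelMul a b) b = a := by
  have h : ∀ a b : Fin 4, (a ^^^ b) ^^^ b = a := by decide
  exact funext fun i => h _ _

lemma labelMul_eq_zero {n : ℕ} {a b : PauliIdx n} : labelMul a b = 0 ↔ a = b := by
  have h : ∀ a b : Fin 4, a ^^^ b = 0 ↔ a = b := by decide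
  simp only [funext_iff, labelMul, Pi.zero_apply, h]

lemma labelMul_zero {n : ℕ} (a : PauliIdx n) : labelMul a 0 = a := by
  have h : ∀ a : Fin 4, a ^^^ 0 = a := by decide
  exact funext fun i => h _

/-- The commutation signs are characters of the label group (ℤ/2)^(2n): bitwise XOR of the codes 0,
1, 2, 3 is multiplication of Pauli matrices up to phase, e.g. 1 xor 2 = 3 for XY ∝ Z. -/
lemma hadamard_labelMul {n : ℕ} (a b c : PauliIdx n) :
    hadamard n (labelMul a b) c = hadamard n a c * hadamard n b c := by
  have h : ∀ a b c : Fin 4, pauliSign (a ^^^ b) c = pauliSign a c * pauliSign b c := by decide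
  simp only [hadamard_apply, labelMul, h, Int.cast_mul, Finset.prod_mul_distrib]

lemma hadamard_mul_hadamard (n : ℕ) : hadamard n * hadamard n = (4 ^ n : ℝ) • 1 := by
  ext a b
  simp only [Matrix.mul_apply, fun c => hadamard_symm c b, ← hadamard_labelMul, sum_hadamard,
    labelMul_eq_zero, Matrix.smul_apply, Matrix.one_apply]
  split_ifs <;> simp

lemma sum_channelDiag {n : ℕ} (p : PauliIdx n → ℝ) : ∑ a, channelDiag p a = 4 ^ n * p 0 := by
  simp only [channelDiag, Matrix.mulVec, dotProduct]
  rw [Finset.sum_comm]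
  have h : ∀ b, ∑ a, hadamard n a b = if b = 0 then 4 ^ n else 0 := fun b => by
    rw [← sum_hadamard]
    exact Finset.sum_congr rfl fun a _ => hadamard_symm a b
  simp only [← Finset.sum_mul, h]
  simp

lemma gateErrorProb_pauliChannel {n : ℕ} (p : PauliIdx n → ℝ) :
    gateErrorProb (ptm (pauliChannel p)) = 1 - p 0 := by
  rw [gateErrorProb, ptm_pauliChannel, Matrix.trace_diagonal, sum_channelDiag]
  field_simp

lemma IsProbVec.sum_erase {n : ℕ} {p : PauliIdx n → ℝ} (hp : IsProbVec p) :
    ∑ b ∈ Finset.univ.erase 0, p b = 1 - p 0 := by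
  rw [← hp.2, ← Finset.add_sum_erase _ _ (Finset.mem_univ 0)]
  ring

lemma IsProbVec.abs_channelDiag_le_one {n : ℕ} {p : PauliIdx n → ℝ} (hp : IsProbVec p)
    (a : PauliIdx n) : |channelDiag p a| ≤ 1 := by
  rw [← hp.2]
  refine (Finset.abs_sum_le_sum_abs _ _).trans (Finset.sum_le_sum fun b _ => ?_)
  rw [abs_mul, abs_hadamard, one_mul, abs_of_nonneg (hp.1 b)]

lemma IsProbVec.channelDiag_zero {n : ℕ} {p : PauliIdx n → ℝ} (hp : IsProbVec p) :
    channelDiag p 0 = 1 := by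
  simp only [channelDiag, Matrix.mulVec, dotProduct, hadamard_symm 0, hadamard_zero, one_mul, hp.2]

/-- The identity contributes p 0 with sign +1, and the other labels can cancel at most 1 - p 0 < p
0. Thus the noise channel is invertible. -/
lemma IsProbVec.channelDiag_pos {n : ℕ} {p : PauliIdx n → ℝ} (hp : IsProbVec p)
    (h0 : 1 / 2 < p 0) (a : PauliIdx n) : 0 < channelDiag p a := by
  have h : channelDiag p a = p 0 + ∑ b ∈ Finset.univ.erase 0, hadamard n a b * p b := by
    rw [channelDiag, Matrix.mulVec, dotProduct, ← Finset.add_sum_erase _ _ (Finset.mem_univ 0),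
      hadamard_zero, one_mul]
  have h2 : |∑ b ∈ Finset.univ.erase 0, hadamard n a b * p b| ≤ 1 - p 0 := by
    rw [← hp.sum_erase]
    refine (Finset.abs_sum_le_sum_abs _ _).trans (Finset.sum_le_sum fun b _ => ?_)
    rw [abs_mul, abs_hadamard, one_mul, abs_of_nonneg (hp.1 b)]
  have := (abs_le.1 h2).1
  linarith

/-! ### The inverse channel and its sampling cost. -/

lemma hadamard_mulVec_quasiProb {n : ℕ} (p : PauliIdx n → ℝ) (a : PauliIdx n) :
    (hadamard n).mulVec (quasiProb p) a = 1 / channelDiag p a := by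
  rw [quasiProb, Matrix.mulVec_smul, Matrix.mulVec_mulVec, hadamard_mul_hadamard,
    Matrix.smul_mulVec, Matrix.one_mulVec, smul_smul]
  simp

/-- Trace preservation, c(0) = 1, forces the quasi-probabilities to sum to 1. -/
lemma IsProbVec.one_le_quasiProbNorm {n : ℕ} {p : PauliIdx n → ℝ} (hp : IsProbVec p) :
    1 ≤ quasiProbNorm p := by
  have h := hadamard_mulVec_quasiProb p 0
  rw [hp.channelDiag_zero] at h
  simp only [Matrix.mulVec, dotProduct, hadamard_symm 0, hadamard_zero, one_mul] at h
  calc (1 : ℝ) = |∑ a, quasiProb p a| := by rw [h]; norm_num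
    _ ≤ _ := Finset.abs_sum_le_sum_abs _ _

/-- The quasi-probability vector is the inverse of `p` under convolution of labels. -/
lemma sum_mul_quasiProb_labelMul {n : ℕ} {p : PauliIdx n → ℝ} (hc : ∀ a, channelDiag p a ≠ 0)
    (a : PauliIdx n) : ∑ b, p b * quasiProb p (labelMul a b) = if a = 0 then 1 else 0 := by
  have h : ∑ b, p b * quasiProb p (labelMul a b)
      = 1 / 4 ^ n * ∑ c, hadamard n a c * (channelDiag p c * (1 / channelDiag p c)) := by
    simp only [quasiProb, Pi.smul_apply, smul_eq_mul, Matrix.mulVec, dotProduct,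
      hadamard_labelMul, Finset.mul_sum]
    rw [Finset.sum_comm]
    refine Finset.sum_congr rfl fun c _ => ?_
    conv_rhs => enter [2, 2, 1]; rw [channelDiag, Matrix.mulVec, dotProduct]
    simp only [Finset.sum_mul, Finset.mul_sum]
    exact Finset.sum_congr rfl fun b _ => by rw [hadamard_symm b c]; ring
  have h1 : ∀ c, channelDiag p c * (1 / channelDiag p c) = 1 := fun c => by
    rw [mul_one_div, div_self (hc c)]
  rw [h]
  simp only [h1, mul_one, sum_hadamard]
  split_ifs <;> simp

/-- Isolating the b = 0 term of the convolution identity p * α = δ and taking ℓ¹ norms gives p 0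
‖α‖₁ ≤ 1 + (1 - p 0) ‖α‖₁. -/
lemma IsProbVec.quasiProbNorm_mul_le {n : ℕ} {p : PauliIdx n → ℝ} (hp : IsProbVec p)
    (h0 : 1 / 2 < p 0) : quasiProbNorm p * (2 * p 0 - 1) ≤ 1 := by
  have h1 : ∀ a, p 0 * |quasiProb p a| ≤ (if a = 0 then 1 else 0) +
      ∑ b ∈ Finset.univ.erase 0, p b * |quasiProb p (labelMul a b)| := by
    intro a
    have h := sum_mul_quasiProb_labelMul (fun a => (hp.channelDiag_pos h0 a).ne') a
    rw [← Finset.add_sum_erase _ _ (Finset.mem_univ 0), labelMul_zero] at h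
    have h2 : |∑ b ∈ Finset.univ.erase 0, p b * quasiProb p (labelMul a b)|
        ≤ ∑ b ∈ Finset.univ.erase 0, p b * |quasiProb p (labelMul a b)| := by
      refine (Finset.abs_sum_le_sum_abs _ _).trans (Finset.sum_le_sum fun b _ => ?_)
      rw [abs_mul, abs_of_nonneg (hp.1 b)]
    have h3 : p 0 * |quasiProb p a| = |(if a = 0 then 1 else 0) -
        ∑ b ∈ Finset.univ.erase 0, p b * quasiProb p (labelMul a b)| := by
      rw [← h, add_sub_cancel_right, abs_mul, abs_of_nonneg (hp.1 0)]
    have h4 : |(if a = 0 then 1 else 0 : ℝ)| = if a = 0 then 1 else 0 := by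
      split_ifs <;> simp
    rw [h3]
    refine (abs_sub _ _).trans ?_
    rw [h4]
    gcongr
  have h2 := Finset.sum_le_sum fun a (_ : a ∈ Finset.univ) => h1 a
  rw [← Finset.mul_sum, Finset.sum_add_distrib, Finset.sum_comm] at h2
  have h3 : ∀ b : PauliIdx n, ∑ a, p b * |quasiProb p (labelMul a b)|
      = p b * quasiProbNorm p := by
    intro b
    rw [← Finset.mul_sum, quasiProbNorm]
    congr 1
    -- Translation by b is an involution of the labels, so it preserves the ℓ¹ norm.
    exact Function.Bijective.sum_comp
      (Function.Involutive.bijective fun a => labelMul_labelMul a b) fun a => |quasiProb p a|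
  simp only [h3, ← Finset.sum_mul, hp.sum_erase, Finset.sum_ite_eq', Finset.mem_univ,
    if_true] at h2
  change p 0 * quasiProbNorm p ≤ _ at h2
  linarith

/-- Exchanging the sums over labels and samples turns empirical frequencies into a sample mean, the
form to which moment computations apply. -/
lemma residualChannel_eq_diagonal {n : ℕ} (p : PauliIdx n → ℝ) (N : ℕ) (l : ℕ → PauliIdx n) :
    residualChannel p N l = Matrix.diagonal fun a => channelDiag p a * (1 / N *
      ∑ i ∈ Finset.range N,
        quasiProbNorm p * (Real.sign (quasiProb p (l i)) * hadamard n (l i) a)) := by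
  have h : approxInverse p N l = Matrix.diagonal fun a => 1 / N * ∑ i ∈ Finset.range N,
      quasiProbNorm p * (Real.sign (quasiProb p (l i)) * hadamard n (l i) a) := by
    ext a b
    simp only [approxInverse, ptm_conjBy_pauliOp, Matrix.sum_apply, Matrix.smul_apply,
      Matrix.diagonal_apply, smul_eq_mul]
    split_ifs with hab
    · simp only [empiricalFreq, Finset.mul_sum, Finset.sum_mul]
      rw [Finset.sum_comm]
      refine Finset.sum_congr rfl fun i _ => ?_
      rw [Finset.sum_eq_single (l i)]
      · simp
        ring
      · intro c _ hc
        simp [Ne.symm hc]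
      · simp
    · simp
  rw [residualChannel, h, ptm_pauliChannel, Matrix.diagonal_mul_diagonal]
  congr 1
  ext a
  ring

/-! ### Asymptotics of the bound -/

lemma sigmaU_eq {ε : ℝ} (hε : ε < 1 / 2) : sigmaU ε = (1 / (1 - 2 * ε)) ^ 2 - 1 := by
  have h : 1 - 2 * ε ≠ 0 := by linarith
  have h2 : 4 * ε * (1 - ε) = 1 - (1 - 2 * ε) ^ 2 := by ring
  rw [sigmaU, ← mul_div_assoc, h2, sub_div, div_self (pow_ne_zero 2 h), one_div_pow]

lemma sigmaU_nonneg {ε : ℝ} (h0 : 0 ≤ ε) (h1 : ε < 1 / 2) : 0 ≤ sigmaU ε :=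
  mul_nonneg (by linarith) (div_nonneg (by linarith) (sq_nonneg _))

lemma epsTilde_isEquivalent : epsTilde ~[𝓝 0] fun ε : ℝ => 10 * ε := by
  rw [isEquivalent_iff_exists_eq_mul]
  refine ⟨fun ε => (1 - ε) / (1 - 2 * ε) ^ 2 + 2 / 5 * ε * ((1 - ε) / (1 - 2 * ε) ^ 2) ^ 2, ?_,
    Eventually.of_forall fun ε => ?_⟩
  · have h : ContinuousAt (fun ε : ℝ => (1 - ε) / (1 - 2 * ε) ^ 2
        + 2 / 5 * ε * ((1 - ε) / (1 - 2 * ε) ^ 2) ^ 2) 0 := by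
      fun_prop (disch := norm_num)
    have h2 := h.tendsto
    norm_num at h2
    exact h2
  · simp only [epsTilde, sigmaU, Pi.mul_apply]
    ring

lemma exp_sub_one_isEquivalent : (fun x : ℝ => Real.exp x - 1) ~[𝓝 0] fun x => x := by
  have h := (Real.hasDerivAt_exp 0).isLittleO
  simpa [IsEquivalent, Pi.sub_def] using! h

lemma isEquivalent_sqrt {α : Type*} {u v : α → ℝ} {f : Filter α} (h : u ~[f] v) :
    (fun x => √(u x)) ~[f] fun x => √(v x) := by
  obtain ⟨φ, hφ, huv⟩ := h.exists_eq_mul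
  rw [isEquivalent_iff_exists_eq_mul]
  refine ⟨fun x => √(φ x), by simpa using hφ.sqrt, ?_⟩
  -- The ratio is eventually positive, which alone lets the square root split; no sign of `v` is
  -- needed.
  filter_upwards [huv, hφ.eventually_const_lt (zero_lt_one' ℝ)] with x hx hx2
  rw [hx, Pi.mul_apply, Pi.mul_apply, Real.sqrt_mul hx2.le]

lemma rmseBound_isEquivalent (n NG : ℕ) (Ns : ℝ) :
    (fun ε : ℝ => rmseBound n NG Ns (epsTilde ε))
      ~[𝓝[>] 0] fun ε : ℝ => rmseBound n NG Ns (10 * ε) := by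
  have h1 : (fun ε : ℝ => epsTilde ε * NG / Ns) ~[𝓝 0] fun ε : ℝ => 10 * ε * NG / Ns := by
    simp only [mul_div_assoc _ (NG : ℝ)]
    exact epsTilde_isEquivalent.mul IsEquivalent.refl
  have h2 : Tendsto (fun ε : ℝ => 10 * ε * NG / Ns) (𝓝 0) (𝓝 0) := by
    have h : Continuous (fun ε : ℝ => 10 * ε * NG / Ns) := by fun_prop
    simpa using h.tendsto 0
  have h3 : (fun ε : ℝ => Real.exp (epsTilde ε * NG / Ns) - 1)
      ~[𝓝 0] fun ε : ℝ => Real.exp (10 * ε * NG / Ns) - 1 :=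
    ((exp_sub_one_isEquivalent.comp_tendsto (h1.symm.tendsto_nhds h2)).trans h1).trans
      (exp_sub_one_isEquivalent.comp_tendsto h2).symm
  exact (IsEquivalent.refl.mul (isEquivalent_sqrt h3)).mono nhdsWithin_le_nhds

/-! ### Moments of empirical means -/

lemma integral_mean_eq {Ω : Type*} [MeasurableSpace Ω] {P : Measure Ω} {N : ℕ} (hN : 0 < N)
    {X : ℕ → Ω → ℝ} {m : ℝ}
    (hX : ∀ i < N, Integrable (X i) P) (hm : ∀ i < N, ∫ ω, X i ω ∂P = m) :
    ∫ ω, 1 / (N : ℝ) * ∑ i ∈ Finset.range N, X i ω ∂P = m := by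
  rw [integral_const_mul, integral_finsetSum _ fun i hi => hX i (Finset.mem_range.1 hi),
    Finset.sum_congr rfl fun i hi => hm i (Finset.mem_range.1 hi)]
  simp [hN.ne']

section Moments

variable {Ω : Type*} [MeasurableSpace Ω] {P : Measure Ω} [IsProbabilityMeasure P]

lemma integrable_comp_of_finite {β : Type*} [MeasurableSpace β] [Finite β]
    [MeasurableSingletonClass β] {Y : Ω → β} (hY : Measurable Y) (F : β → ℝ) :
    Integrable (fun ω => F (Y ω)) P :=
  (Integrable.of_finite (μ := P.map Y) (f := F)).comp_measurable hY

lemma memLp_two_comp_of_finite {β : Type*} [MeasurableSpace β] [Finite β]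
    [MeasurableSingletonClass β] {Y : Ω → β} (hY : Measurable Y) (F : β → ℝ) :
    MemLp (fun ω => F (Y ω)) 2 P :=
  (memLp_two_iff_integrable_sq (integrable_comp_of_finite hY F).aestronglyMeasurable).2
    (integrable_comp_of_finite hY fun b => F b ^ 2)

lemma integral_comp_of_fintype {β : Type*} [MeasurableSpace β] [Fintype β]
    [MeasurableSingletonClass β] {Y : Ω → β} (hY : Measurable Y) (F : β → ℝ) :
    ∫ ω, F (Y ω) ∂P = ∑ b, P.real {ω | Y ω = b} * F b := by
  rw [← integral_map hY.aemeasurable (f := F) AEStronglyMeasurable.of_discrete,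
    integral_fintype .of_finite]
  refine Finset.sum_congr rfl fun b _ => ?_
  rw [map_measureReal_apply hY (measurableSet_singleton b), smul_eq_mul]
  rfl

/-- Squared mean plus variance: pairwise independence divides the single-sample variance, at most B
- m², by N. -/
lemma integral_sq_mean_le {N : ℕ} (hN : 0 < N) {X : ℕ → Ω → ℝ} {m B : ℝ}
    (hX : ∀ i < N, MemLp (X i) 2 P) (hm : ∀ i < N, ∫ ω, X i ω ∂P = m)
    (hB : ∀ i < N, ∀ ω, X i ω ^ 2 ≤ B)
    (hind : ∀ i < N, ∀ j < N, i ≠ j → IndepFun (X i) (X j) P) :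
    ∫ ω, (1 / (N : ℝ) * ∑ i ∈ Finset.range N, X i ω) ^ 2 ∂P ≤ m ^ 2 + (B - m ^ 2) / N := by
  have hsum : variance (∑ i ∈ Finset.range N, X i) P = ∑ i ∈ Finset.range N, variance (X i) P :=
    IndepFun.variance_sum (fun i hi => hX i (Finset.mem_range.1 hi)) fun i hi j hj hij =>
      hind i (by simpa using hi) j (by simpa using hj) hij
  have hvar : ∀ i ∈ Finset.range N, variance (X i) P ≤ B - m ^ 2 := by
    intro i hi
    have hi := Finset.mem_range.1 hi
    rw [variance_eq_sub (hX i hi), hm i hi]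
    gcongr
    calc ∫ ω, (X i ^ 2) ω ∂P ≤ ∫ _, B ∂P :=
          integral_mono ((hX i hi).integrable_sq) (integrable_const B) fun ω => hB i hi ω
      _ = B := by simp
  have hL : MemLp (∑ i ∈ Finset.range N, X i) 2 P :=
    memLp_finsetSum' _ fun i hi => hX i (Finset.mem_range.1 hi)
  have hN' : (0 : ℝ) < N := by exact_mod_cast hN
  have hmean : ∫ ω, (∑ i ∈ Finset.range N, X i) ω ∂P = N * m := by
    simp only [Finset.sum_apply]
    rw [integral_finsetSum _ fun i hi => (hX i (Finset.mem_range.1 hi)).integrable one_le_two,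
      Finset.sum_congr rfl fun i hi => hm i (Finset.mem_range.1 hi)]
    simp
  have hle := Finset.sum_le_sum hvar
  rw [← hsum, variance_eq_sub hL, hmean, Finset.sum_const, Finset.card_range, nsmul_eq_mul] at hle
  have hint : ∫ ω, (1 / (N : ℝ) * ∑ i ∈ Finset.range N, X i ω) ^ 2 ∂P
      = (1 / (N : ℝ)) ^ 2 * ∫ ω, ((∑ i ∈ Finset.range N, X i) ^ 2) ω ∂P := by
    rw [← integral_const_mul]
    simp only [Pi.pow_apply, Finset.sum_apply, mul_pow]
  rw [hint]
  calc _ ≤ (1 / (N : ℝ)) ^ 2 * (N * (B - m ^ 2) + (N * m) ^ 2) := by gcongr; linarith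
    _ = _ := by field_simp; ring

/-! ### The residual channel of one gate -/

/-- The diagonal entry at `a` of the residual channel. -/
noncomputable def residualDiag {n : ℕ} (p : PauliIdx n → ℝ) (N : ℕ) (l : ℕ → PauliIdx n)
    (a : PauliIdx n) : ℝ :=
  channelDiag p a * (1 / N * ∑ i ∈ Finset.range N,
    quasiProbNorm p * (Real.sign (quasiProb p (l i)) * hadamard n (l i) a))

lemma residualChannel_mulVec {n : ℕ} (p : PauliIdx n → ℝ) (N : ℕ) (l : ℕ → PauliIdx n)
    (v : PauliIdx n → ℝ) (a : PauliIdx n) :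
    (residualChannel p N l).mulVec v a = residualDiag p N l a * v a := by
  rw [residualChannel_eq_diagonal, Matrix.mulVec_diagonal, residualDiag]

lemma residualDiag_congr {n : ℕ} (p : PauliIdx n → ℝ) {N : ℕ} {l l' : ℕ → PauliIdx n}
    (h : ∀ i < N, l i = l' i) (a : PauliIdx n) :
    residualDiag p N l a = residualDiag p N l' a := by
  rw [residualDiag, residualDiag]
  congr 2
  exact Finset.sum_congr rfl fun i hi => by rw [h i (Finset.mem_range.1 hi)]

/-- Importance sampling: the weight ‖α‖₁ sgn(α_b) times the probability |α_b| / ‖α‖₁ is α_b, so the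
mean is an entry of Hα = 1 / c. -/
lemma integral_signed_sample {n : ℕ} {p : PauliIdx n → ℝ} (hp : IsProbVec p)
    {Y : Ω → PauliIdx n} (hY : Measurable Y)
    (hlaw : ∀ b, P.real {ω | Y ω = b} = samplingProb p b) (a : PauliIdx n) :
    ∫ ω, quasiProbNorm p * (Real.sign (quasiProb p (Y ω)) * hadamard n (Y ω) a) ∂P
      = 1 / channelDiag p a := by
  have hnorm : quasiProbNorm p ≠ 0 := (zero_lt_one.trans_le hp.one_le_quasiProbNorm).ne'
  rw [integral_comp_of_fintype hY fun b =>
    quasiProbNorm p * (Real.sign (quasiProb p b) * hadamard n b a), ← hadamard_mulVec_quasiProb]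
  refine Finset.sum_congr rfl fun b _ => ?_
  have h : Real.sign (quasiProb p b) * |quasiProb p b| = quasiProb p b := by
    rcases lt_trichotomy (quasiProb p b) 0 with hb | hb | hb
    · rw [Real.sign_of_neg hb, abs_of_neg hb, neg_mul_neg, one_mul]
    · rw [hb, abs_zero, mul_zero]
    · rw [Real.sign_of_pos hb, abs_of_pos hb, one_mul]
  change _ = hadamard n a b * quasiProb p b
  rw [hlaw, samplingProb, hadamard_symm a b]
  conv_rhs => rw [← h]
  field_simp

lemma integral_residualDiag {n : ℕ} {p : PauliIdx n → ℝ} (hp : IsProbVec p) (h0 : 1 / 2 < p 0)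
    {N : ℕ} (hN : 0 < N) {l : ℕ → Ω → PauliIdx n} (hl : ∀ i < N, Measurable (l i))
    (hlaw : ∀ i < N, ∀ b, P.real {ω | l i ω = b} = samplingProb p b) (a : PauliIdx n) :
    ∫ ω, residualDiag p N (fun i => l i ω) a ∂P = 1 := by
  simp only [residualDiag]
  rw [integral_const_mul, integral_mean_eq hN
    (fun i hi => integrable_comp_of_finite (hl i hi) fun b =>
      quasiProbNorm p * (Real.sign (quasiProb p b) * hadamard n b a))
    fun i hi => integral_signed_sample hp (hl i hi) (hlaw i hi) a]
  exact mul_one_div_cancel (hp.channelDiag_pos h0 a).ne'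

lemma integral_sq_residualDiag_le {n : ℕ} {p : PauliIdx n → ℝ} (hp : IsProbVec p)
    (h0 : 1 / 2 < p 0) {N : ℕ} (hN : 0 < N) {l : ℕ → Ω → PauliIdx n}
    (hl : ∀ i < N, Measurable (l i))
    (hind : ∀ i < N, ∀ j < N, i ≠ j → IndepFun (l i) (l j) P)
    (hlaw : ∀ i < N, ∀ b, P.real {ω | l i ω = b} = samplingProb p b) (a : PauliIdx n) :
    ∫ ω, residualDiag p N (fun i => l i ω) a ^ 2 ∂P ≤ 1 + (quasiProbNorm p ^ 2 - 1) / N := by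
  have hc := hp.channelDiag_pos h0 a
  have hc1 : channelDiag p a ^ 2 ≤ 1 :=
    pow_le_one₀ hc.le ((le_abs_self _).trans (hp.abs_channelDiag_le_one a))
  have h := integral_sq_mean_le (P := P) hN (B := quasiProbNorm p ^ 2)
    (fun i hi => memLp_two_comp_of_finite (hl i hi) fun b =>
      quasiProbNorm p * (Real.sign (quasiProb p b) * hadamard n b a))
    (fun i hi => integral_signed_sample hp (hl i hi) (hlaw i hi) a)
    (fun i _ ω => by
      have h1 : hadamard n (l i ω) a ^ 2 = 1 := by rw [← sq_abs, abs_hadamard, one_pow]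
      have h2 : Real.sign (quasiProb p (l i ω)) ^ 2 ≤ 1 := by
        rcases Real.sign_apply_eq (quasiProb p (l i ω)) with h | h | h <;> rw [h] <;> norm_num
      rw [mul_pow, mul_pow, h1, mul_one]
      exact mul_le_of_le_one_right (sq_nonneg _) h2)
    (fun i hi j hj hij => (hind i hi j hj hij).comp
      (measurable_of_finite fun b =>
        quasiProbNorm p * (Real.sign (quasiProb p b) * hadamard n b a))
      (measurable_of_finite fun b =>
        quasiProbNorm p * (Real.sign (quasiProb p b) * hadamard n b a)))
  simp only [residualDiag, mul_pow (channelDiag p a)]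
  rw [integral_const_mul]
  have hN' : (0 : ℝ) < N := by exact_mod_cast hN
  -- With m = 1 / c and B = ‖α‖₁², the prefactor c² turns m² into 1; afterwards c² ≤ 1 removes the
  -- dependence on the label.
  calc _ ≤ channelDiag p a ^ 2 * ((1 / channelDiag p a) ^ 2
          + (quasiProbNorm p ^ 2 - (1 / channelDiag p a) ^ 2) / N) := by
        gcongr
    _ = 1 + (channelDiag p a ^ 2 * quasiProbNorm p ^ 2 - 1) / N := by
        field_simp
    _ ≤ _ := by
        gcongr
        exact mul_le_of_le_one_left (sq_nonneg _) hc1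

lemma IsProbVec.quasiProbNorm_sq_sub_one_le {n : ℕ} {p : PauliIdx n → ℝ} (hp : IsProbVec p)
    {ε : ℝ} (hε : ε < 1 / 2) (hpε : 1 - p 0 ≤ ε) : quasiProbNorm p ^ 2 - 1 ≤ sigmaU ε := by
  have h := hp.quasiProbNorm_mul_le (by linarith)
  have h1 := hp.one_le_quasiProbNorm
  rw [sigmaU_eq hε]
  gcongr
  rw [le_div_iff₀ (by linarith)]
  nlinarith

lemma IsProbVec.apply_le_one {n : ℕ} {p : PauliIdx n → ℝ} (hp : IsProbVec p) (a : PauliIdx n) :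
    p a ≤ 1 := by
  rw [← hp.2]
  exact Finset.single_le_sum (fun b _ => hp.1 b) (Finset.mem_univ a)

end Moments

/-! ### The protected circuit -/

lemma sum_sq_ptmVec {n : ℕ} {A : Op n} (hA : A.IsHermitian) :
    ∑ a, ptmVec A a ^ 2 = (A * A).trace.re := by
  rw [← ptmVec_dotProduct_ptmVec hA]
  simp only [dotProduct, sq]

lemma sum_sq_ptmVec_le {n : ℕ} {M : Op n} (hM : M.IsHermitian)
    (hM1 : ∀ j, hM.eigenvalues j ∈ Set.Icc (-1 : ℝ) 1) : ∑ a, ptmVec M a ^ 2 ≤ 2 ^ n := by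
  have h : (M * M).trace.re = ∑ j, hM.eigenvalues j ^ 2 := by
    conv_lhs => rw [hM.spectral_theorem, ← map_mul, Unitary.conjStarAlgAut_apply,
      Matrix.trace_mul_comm, ← Matrix.mul_assoc, Unitary.coe_star_mul_self, Matrix.one_mul,
      Matrix.diagonal_mul_diagonal, Matrix.trace_diagonal]
    simp [sq]
  rw [sum_sq_ptmVec hM, h]
  calc ∑ j, hM.eigenvalues j ^ 2 ≤ ∑ _j : Fin n → Fin 2, (1 : ℝ) :=
        Finset.sum_le_sum fun j _ => (sq_le_one_iff_abs_le_one _).2 (abs_le.2 (hM1 j))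
    _ = _ := by simp

lemma isHermitian_initialState (n : ℕ) : (initialState n).IsHermitian := by
  simp [initialState, Matrix.IsHermitian, Matrix.conjTranspose_single]

/-- The vector of the ideal state after `k` gates. -/
noncomputable def idealVec {n : ℕ} (U : ℕ → Op n) (k : ℕ) : PauliIdx n → ℝ :=
  ptmVec (conjBy (idealCircuit U k) (initialState n))

lemma idealVec_zero {n : ℕ} (U : ℕ → Op n) : idealVec U 0 = ptmVec (initialState n) := by
  simp [idealVec, idealCircuit, conjBy]

lemma idealVec_succ {n : ℕ} (U : ℕ → Op n) (k : ℕ) :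
    idealVec U (k + 1) = (ptm (conjBy (U k))).mulVec (idealVec U k) := by
  rw [idealVec, idealVec, ptm_conjBy_mulVec_ptmVec]
  simp only [idealCircuit, conjBy, Matrix.conjTranspose_mul, Matrix.mul_assoc]

lemma sum_sq_idealVec {n : ℕ} (U : ℕ → Op n) {k : ℕ}
    (hU : ∀ j < k, U j ∈ Matrix.unitaryGroup (Fin n → Fin 2) ℂ) :
    ∑ a, idealVec U k a ^ 2 = 1 := by
  induction k with
  | zero =>
    rw [idealVec_zero, sum_sq_ptmVec (isHermitian_initialState n)]
    simp [initialState]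
  | succ k ih =>
    rw [idealVec_succ, sum_sq_ptm_conjBy_mulVec (hU k k.lt_succ_self),
      ih fun j hj => hU j (hj.trans k.lt_succ_self)]

lemma idealResult_eq {n : ℕ} {M : Op n} (hM : M.IsHermitian) (U : ℕ → Op n) (k : ℕ) :
    idealResult M U k = ptmVec M ⬝ᵥ idealVec U k := by
  rw [idealVec, ptmVec_dotProduct_ptmVec hM, trace_mul_conjBy, conjBy,
    Matrix.conjTranspose_conjTranspose, initialState, Matrix.trace_single_mul, idealResult]
  simp

lemma sq_dotProduct_le {ι : Type*} [Fintype ι] (u v : ι → ℝ) :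
    (u ⬝ᵥ v) ^ 2 ≤ (∑ a, u a ^ 2) * ∑ a, v a ^ 2 :=
  Finset.sum_mul_sq_le_sq_mul_sq _ _ _

/-- Diagonality makes the fresh randomness a scalar factor in each coordinate, so independence of
different coordinates is never needed. -/
lemma mitigatedState_succ {n : ℕ} (U : ℕ → Op n) (p : ℕ → PauliIdx n → ℝ) (N : ℕ → ℕ)
    (l : ℕ → ℕ → PauliIdx n) (k : ℕ) (a : PauliIdx n) :
    mitigatedState U p N l (k + 1) a = residualDiag (p k) (N k) (l k) a *
      (ptm (conjBy (U k))).mulVec (mitigatedState U p N l k) a := by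
  rw [mitigatedState, ← Matrix.mulVec_mulVec, residualChannel_mulVec]

lemma mitigatedState_congr {n : ℕ} (U : ℕ → Op n) (p : ℕ → PauliIdx n → ℝ) {N : ℕ → ℕ}
    {l l' : ℕ → ℕ → PauliIdx n} {k : ℕ} (h : ∀ j < k, ∀ i < N j, l j i = l' j i) :
    mitigatedState U p N l k = mitigatedState U p N l' k := by
  induction k with
  | zero => rfl
  | succ k ih =>
    ext a
    rw [mitigatedState_succ, mitigatedState_succ,
      ih fun j hj => h j (hj.trans k.lt_succ_self),
      residualDiag_congr (p k) (h k k.lt_succ_self)]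

/-- Extends a family of labels over a finite set of samples by the label `0`. -/
def extendLabels {n NG : ℕ} {N : ℕ → ℕ} (T : Finset ((k : Fin NG) × Fin (N k)))
    (g : T → PauliIdx n) (k i : ℕ) : PauliIdx n :=
  if h : ∃ (hk : k < NG) (hi : i < N k), ⟨⟨k, hk⟩, ⟨i, hi⟩⟩ ∈ T then
    g ⟨⟨⟨k, h.1⟩, ⟨i, h.2.1⟩⟩, h.2.2⟩ else 0

lemma extendLabels_restrict {n NG : ℕ} {N : ℕ → ℕ} (T : Finset ((k : Fin NG) × Fin (N k)))
    (l : ℕ → ℕ → PauliIdx n) {k i : ℕ} (hk : k < NG) (hi : i < N k)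
    (h : (⟨⟨k, hk⟩, ⟨i, hi⟩⟩ : (k : Fin NG) × Fin (N k)) ∈ T) :
    extendLabels T (fun q => l q.1.1 q.1.2) k i = l k i :=
  dif_pos ⟨hk, hi, h⟩

section Circuit

variable {Ω : Type*} [MeasurableSpace Ω] {P : Measure Ω}
  {n NG : ℕ} (U : ℕ → Op n) (p : ℕ → PauliIdx n → ℝ) {N : ℕ → ℕ} {l : ℕ → ℕ → Ω → PauliIdx n}

/-- The samples of gate `k` are independent of the state before that gate. -/
lemma indepFun_residualDiag (hl : ∀ k < NG, ∀ i < N k, Measurable (l k i))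
    (hind : iIndepFun (fun q : (k : Fin NG) × Fin (N k) => l q.1 q.2) P)
    {k : ℕ} (hk : k < NG) (a : PauliIdx n) :
    IndepFun (fun ω => residualDiag (p k) (N k) (fun i => l k i ω) a)
      (fun ω => (ptm (conjBy (U k))).mulVec
        (mitigatedState U p N (fun k i => l k i ω) k) a) P := by
  classical
  -- `S` collects the samples of gate `k`, `T` those of all earlier gates.
  let S : Finset ((k : Fin NG) × Fin (N k)) := {q | q.1.1 = k}
  let T : Finset ((k : Fin NG) × Fin (N k)) := {q | q.1.1 < k}
  have hST : Disjoint S T := Finset.disjoint_left.2 fun q hq hq' => by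
    simp only [S, T, Finset.mem_filter, Finset.mem_univ, true_and] at hq hq'
    exact hq'.ne hq
  have h := hind.indepFun_finset S T hST fun q => hl _ q.1.2 _ q.2.2
  -- Both variables factor through label tuples over a finite index set, a finite space on which
  -- every function is measurable; the default labels outside it are never read.
  have h2 := h.comp
    (measurable_of_finite fun g => residualDiag (p k) (N k) (extendLabels S g k) a)
    (measurable_of_finite fun g => (ptm (conjBy (U k))).mulVec
        (mitigatedState U p N (extendLabels T g) k) a)
  convert h2 using 1
  · ext ω
    exact residualDiag_congr _ (fun i hi =>
      (extendLabels_restrict S (fun k i => l k i ω) hk hi (by simp [S])).symm) a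
  · ext ω
    simp only [Function.comp_apply]
    rw [mitigatedState_congr U p fun j hj i hi =>
      (extendLabels_restrict T (fun k i => l k i ω) (hj.trans hk) hi (by simp [T, hj])).symm]

variable [IsProbabilityMeasure P]

lemma integrable_comp_mitigatedState (hl : ∀ k < NG, ∀ i < N k, Measurable (l k i))
    {k : ℕ} (hk : k ≤ NG) (F : (PauliIdx n → ℝ) → ℝ) :
    Integrable (fun ω => F (mitigatedState U p N (fun k i => l k i ω) k)) P := by
  have h := integrable_comp_of_finite (P := P)
    (Y := fun ω (q : (Finset.univ : Finset ((k : Fin NG) × Fin (N k)))) => l q.1.1 q.1.2 ω)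
    (measurable_pi_lambda _ fun q => hl _ q.1.1.2 _ q.1.2.2)
    fun g => F (mitigatedState U p N (extendLabels Finset.univ g) k)
  convert h using 3 with ω
  exact mitigatedState_congr U p fun j hj i hi =>
    (extendLabels_restrict Finset.univ (fun k i => l k i ω) (hj.trans_le hk) hi
      (Finset.mem_univ _)).symm

lemma integrable_comp_residualDiag (hl : ∀ k < NG, ∀ i < N k, Measurable (l k i))
    {k : ℕ} (hk : k < NG) (a : PauliIdx n) (F : ℝ → ℝ) :
    Integrable (fun ω => F (residualDiag (p k) (N k) (fun i => l k i ω) a)) P := by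
  have h := integrable_comp_of_finite (P := P)
    (Y := fun ω (q : (Finset.univ : Finset ((k : Fin NG) × Fin (N k)))) => l q.1.1 q.1.2 ω)
    (measurable_pi_lambda _ fun q => hl _ q.1.1.2 _ q.1.2.2)
    fun g => F (residualDiag (p k) (N k) (extendLabels Finset.univ g k) a)
  convert h using 3 with ω
  exact residualDiag_congr _ (fun i hi =>
    (extendLabels_restrict Finset.univ (fun k i => l k i ω) hk hi (Finset.mem_univ _)).symm) a

variable (hp : ∀ k < NG, IsProbVec (p k)) (h0 : ∀ k < NG, 1 / 2 < p k 0)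
  (hN : ∀ k < NG, 0 < N k) (hl : ∀ k < NG, ∀ i < N k, Measurable (l k i))
  (hind : iIndepFun (fun q : (k : Fin NG) × Fin (N k) => l q.1 q.2) P)
  (hlaw : ∀ k < NG, ∀ i < N k, ∀ a, P.real {ω | l k i ω = a} = samplingProb (p k) a)

include hp h0 hN hl hind hlaw in
lemma integral_mitigatedState {k : ℕ} (hk : k ≤ NG) (a : PauliIdx n) :
    ∫ ω, mitigatedState U p N (fun k i => l k i ω) k a ∂P = idealVec U k a := by
  induction k generalizing a with
  | zero => simp [mitigatedState, idealVec_zero]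
  | succ k ih =>
    have hk' : k < NG := hk
    simp only [mitigatedState_succ]
    rw [(indepFun_residualDiag U p hl hind hk' a).integral_fun_mul_eq_mul_integral
        (integrable_comp_residualDiag p hl hk' a fun x => x).aestronglyMeasurable
        (integrable_comp_mitigatedState U p hl hk'.le fun v =>
          (ptm (conjBy (U k))).mulVec v a).aestronglyMeasurable,
      integral_residualDiag (hp k hk') (h0 k hk') (hN k hk') (hl k hk') (hlaw k hk'), one_mul,
      idealVec_succ]
    simp only [Matrix.mulVec, dotProduct]
    rw [integral_finsetSum _ fun b _ =>
      integrable_comp_mitigatedState U p hl hk'.le fun v => ptm (conjBy (U k)) a b * v b]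
    refine Finset.sum_congr rfl fun b _ => ?_
    rw [integral_const_mul, ih hk'.le]

include hp h0 hN hl hind hlaw in
lemma integral_sum_sq_mitigatedState_le
    (hU : ∀ k < NG, U k ∈ Matrix.unitaryGroup (Fin n → Fin 2) ℂ) {s : ℝ} (hs : 0 ≤ s)
    (hNs : ∀ k < NG, (quasiProbNorm (p k) ^ 2 - 1) / N k ≤ s) {k : ℕ} (hk : k ≤ NG) :
    ∫ ω, ∑ a, mitigatedState U p N (fun k i => l k i ω) k a ^ 2 ∂P ≤ (1 + s) ^ k := by
  induction k with
  | zero =>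
    have h := sum_sq_idealVec U (k := 0) (by simp)
    rw [idealVec_zero] at h
    simp [mitigatedState, h]
  | succ k ih =>
    have hk' : k < NG := hk
    have hint : ∀ a, Integrable (fun ω => (ptm (conjBy (U k))).mulVec
        (mitigatedState U p N (fun k i => l k i ω) k) a ^ 2) P := fun a =>
      integrable_comp_mitigatedState U p hl hk'.le fun v => (ptm (conjBy (U k))).mulVec v a ^ 2
    have hstep : ∀ a, ∫ ω, mitigatedState U p N (fun k i => l k i ω) (k + 1) a ^ 2 ∂P
        ≤ (1 + s) * ∫ ω, (ptm (conjBy (U k))).mulVec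
          (mitigatedState U p N (fun k i => l k i ω) k) a ^ 2 ∂P := by
      intro a
      simp only [mitigatedState_succ, mul_pow]
      have hsq : Measurable fun x : ℝ => x ^ 2 := by fun_prop
      refine (((indepFun_residualDiag U p hl hind hk' a).comp hsq
        hsq).integral_fun_mul_eq_mul_integral
        (integrable_comp_residualDiag p hl hk' a fun x => x ^ 2).aestronglyMeasurable
        (hint a).aestronglyMeasurable).trans_le ?_
      refine mul_le_mul_of_nonneg_right ?_ (integral_nonneg fun ω => sq_nonneg _)
      have hpair : ∀ i < N k, ∀ j < N k, i ≠ j → IndepFun (l k i) (l k j) P :=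
        fun i hi j hj hij => hind.indepFun
          (i := ⟨⟨k, hk'⟩, ⟨i, hi⟩⟩) (j := ⟨⟨k, hk'⟩, ⟨j, hj⟩⟩) (by simpa using hij)
      exact (integral_sq_residualDiag_le (hp k hk') (h0 k hk') (hN k hk') (hl k hk') hpair
        (hlaw k hk') a).trans (by linarith [hNs k hk'])
    rw [integral_finsetSum _ fun a _ =>
      integrable_comp_mitigatedState U p hl hk fun v => v a ^ 2]
    calc _ ≤ ∑ a, (1 + s) * ∫ ω, (ptm (conjBy (U k))).mulVec
            (mitigatedState U p N (fun k i => l k i ω) k) a ^ 2 ∂P :=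
          Finset.sum_le_sum fun a _ => hstep a
      _ = (1 + s) * ∫ ω, ∑ a, mitigatedState U p N (fun k i => l k i ω) k a ^ 2 ∂P := by
          -- The gate mixes coordinates but preserves the sum of squares, so it disappears once the
          -- sum is back inside the integral.
          rw [← Finset.mul_sum, ← integral_finsetSum _ fun a _ => hint a]
          simp only [sum_sq_ptm_conjBy_mulVec (hU k hk')]
      _ ≤ (1 + s) * (1 + s) ^ k := by
          gcongr
          exact ih hk'.le
      _ = _ := by ring

include hp h0 hN hl hind hlaw in
/-- The mean squared error of the mitigated result. -/
lemma integral_sq_error_le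
    (hU : ∀ k < NG, U k ∈ Matrix.unitaryGroup (Fin n → Fin 2) ℂ) {s : ℝ} (hs : 0 ≤ s)
    (hNs : ∀ k < NG, (quasiProbNorm (p k) ^ 2 - 1) / N k ≤ s)
    {M : Op n} (hM : M.IsHermitian) (hM1 : ∀ j, hM.eigenvalues j ∈ Set.Icc (-1 : ℝ) 1) :
    ∫ ω, (mitigatedResult M U p N (fun k i => l k i ω) NG - idealResult M U NG) ^ 2 ∂P
      ≤ 2 ^ n * ((1 + s) ^ NG - 1) := by
  have hint : ∀ F : (PauliIdx n → ℝ) → ℝ,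
      Integrable (fun ω => F (mitigatedState U p N (fun k i => l k i ω) NG)) P :=
    integrable_comp_mitigatedState U p hl le_rfl
  -- Unbiasedness makes this a variance: the expected squared norm minus the squared norm 1 of the
  -- ideal vector.
  have hdev : ∫ ω, ∑ a, (mitigatedState U p N (fun k i => l k i ω) NG a - idealVec U NG a) ^ 2 ∂P
      ≤ (1 + s) ^ NG - 1 := by
    have h : ∀ a, ∫ ω, (mitigatedState U p N (fun k i => l k i ω) NG a - idealVec U NG a) ^ 2 ∂P
        = ∫ ω, mitigatedState U p N (fun k i => l k i ω) NG a ^ 2 ∂P - idealVec U NG a ^ 2 := by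
      intro a
      have hexp : ∀ ω, (mitigatedState U p N (fun k i => l k i ω) NG a - idealVec U NG a) ^ 2
          = mitigatedState U p N (fun k i => l k i ω) NG a ^ 2
            - (2 * idealVec U NG a * mitigatedState U p N (fun k i => l k i ω) NG a
              - idealVec U NG a ^ 2) := fun ω => by ring
      simp only [hexp]
      rw [integral_sub (hint fun v => v a ^ 2)
          (hint fun v => 2 * idealVec U NG a * v a - idealVec U NG a ^ 2),
        integral_sub (hint fun v => 2 * idealVec U NG a * v a) (integrable_const _),
        integral_const_mul, integral_mitigatedState U p hp h0 hN hl hind hlaw le_rfl]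
      simp
      ring
    rw [integral_finsetSum _ fun a _ => hint fun v => (v a - idealVec U NG a) ^ 2]
    simp only [h]
    rw [Finset.sum_sub_distrib, sum_sq_idealVec U hU,
      ← integral_finsetSum _ fun a _ => hint fun v => v a ^ 2]
    gcongr
    exact integral_sum_sq_mitigatedState_le U p hp h0 hN hl hind hlaw hU hs hNs le_rfl
  calc _ ≤ ∫ ω, 2 ^ n *
        ∑ a, (mitigatedState U p N (fun k i => l k i ω) NG a - idealVec U NG a) ^ 2 ∂P := by
        refine integral_mono (hint fun v => (ptmVec M ⬝ᵥ v - idealResult M U NG) ^ 2)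
          (hint fun v => 2 ^ n * ∑ a, (v a - idealVec U NG a) ^ 2) fun ω => ?_
        simp only [mitigatedResult]
        rw [idealResult_eq hM, ← dotProduct_sub]
        exact (sq_dotProduct_le _ _).trans (mul_le_mul_of_nonneg_right (sum_sq_ptmVec_le hM hM1)
          (Finset.sum_nonneg fun a _ => sq_nonneg _))
    _ ≤ _ := by
        rw [integral_const_mul]
        gcongr

end Circuit

end PauliQEM

theorem proposition4
    (n NG : ℕ)
    -- the observable, with eigenvalues in `[-1, 1]`
    (M : PauliQEM.Op n) (hM : M.IsHermitian) (hM1 : ∀ j, hM.eigenvalues j ∈ Set.Icc (-1 : ℝ) 1)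
    -- the gates `0, …, NG - 1`, and the Pauli channels acting after them
    (U : ℕ → PauliQEM.Op n)
    (hU : ∀ k < NG, U k ∈ Matrix.unitaryGroup (Fin n → Fin 2) ℂ)
    (p : ℕ → PauliQEM.PauliIdx n → ℝ) (hp : ∀ k < NG, PauliQEM.IsProbVec (p k))
    -- bounded gate error rate
    (εu : ℝ) (hεu : εu < 1 / 2)
    (hε : ∀ k < NG, PauliQEM.gateErrorProb (PauliQEM.ptm (PauliQEM.pauliChannel (p k))) ≤ εu)
    -- the numbers of samples used for the gates
    (Ns : ℝ) (hNs : 0 < Ns) (N : ℕ → ℕ)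
    (hN : ∀ k < NG, Ns * PauliQEM.quasiProbNorm (p k) ^ 2 ≤ (N k : ℝ))
    -- the independent samples, those for gate `k` being distributed as `|α_k| / ‖α_k‖₁`
    {Ω : Type*} [MeasurableSpace Ω] (P : Measure Ω) [IsProbabilityMeasure P]
    (l : ℕ → ℕ → Ω → PauliQEM.PauliIdx n)
    (hl : ∀ k < NG, ∀ i < N k, Measurable (l k i))
    (hind : iIndepFun (fun q : (k : Fin NG) × Fin (N k) => l q.1 q.2) P)
    (hlaw : ∀ k < NG, ∀ i < N k, ∀ a,
      P.real {ω | l k i ω = a} = PauliQEM.samplingProb (p k) a) :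
    Integrable (fun ω =>
      (PauliQEM.mitigatedResult M U p N (fun k i => l k i ω) NG
        - PauliQEM.idealResult M U NG) ^ 2) P ∧
    √(∫ ω, (PauliQEM.mitigatedResult M U p N (fun k i => l k i ω) NG
        - PauliQEM.idealResult M U NG) ^ 2 ∂P)
      ≤ PauliQEM.rmseBound n NG Ns (PauliQEM.epsTilde εu) ∧
    -- the approximation by `10 ε` for small `ε`
    PauliQEM.epsTilde ~[𝓝 0] (fun ε : ℝ => 10 * ε) ∧
    (fun ε : ℝ => PauliQEM.rmseBound n NG Ns (PauliQEM.epsTilde ε))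
      ~[𝓝[>] 0] (fun ε : ℝ => PauliQEM.rmseBound n NG Ns (10 * ε)) := by

  have hp0 : ∀ k < NG, 1 - p k 0 ≤ εu := fun k hk => by
    rw [← PauliQEM.gateErrorProb_pauliChannel]
    exact hε k hk
  -- Since ‖α_k‖₁ ≥ 1, each gate has at least Ns samples; this weaker count is enough below.
  have hN1 : ∀ k < NG, Ns ≤ N k := fun k hk =>
    (le_mul_of_one_le_right hNs.le
      (one_le_pow₀ (hp k hk).one_le_quasiProbNorm)).trans (hN k hk)
  refine ⟨PauliQEM.integrable_comp_mitigatedState U p hl le_rfl fun v =>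
      (PauliQEM.ptmVec M ⬝ᵥ v - PauliQEM.idealResult M U NG) ^ 2, ?_,
    PauliQEM.epsTilde_isEquivalent, PauliQEM.rmseBound_isEquivalent n NG Ns⟩
  obtain ⟨s, hs, hsN, hsE⟩ : ∃ s : ℝ, 0 ≤ s ∧
      (∀ k < NG, (PauliQEM.quasiProbNorm (p k) ^ 2 - 1) / N k ≤ s) ∧
      s * NG ≤ PauliQEM.epsTilde εu * NG / Ns := by
    -- Without gates nothing forces εu ≥ 0, so σ / Ns may be negative and s = 0 is taken instead.
    rcases Nat.eq_zero_or_pos NG with h | h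
    · exact ⟨0, le_rfl, by simp [h], by simp [h]⟩
    · have hε0 : 0 ≤ εu := by linarith [hp0 0 h, (hp 0 h).apply_le_one 0]
      have hσ := PauliQEM.sigmaU_nonneg hε0 hεu
      refine ⟨PauliQEM.sigmaU εu / Ns, by positivity, fun k hk => ?_, ?_⟩
      · have hle := hN1 k hk
        have := (hp k hk).quasiProbNorm_sq_sub_one_le hεu (hp0 k hk)
        gcongr
      · rw [div_mul_eq_mul_div]
        gcongr
        rw [PauliQEM.epsTilde]
        -- For σ ≥ 0, already σ ≤ (5/2) σ + (1/4) σ²; the stated constant leaves slack.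
        nlinarith
  have h := PauliQEM.integral_sq_error_le U p hp (fun k hk => by linarith [hp0 k hk])
    (fun k hk => by exact_mod_cast hNs.trans_le (hN1 k hk)) hl hind hlaw hU hs hsN hM hM1
  have hexp : (1 + s) ^ NG ≤ Real.exp (PauliQEM.epsTilde εu * NG / Ns) :=
    calc (1 + s) ^ NG ≤ Real.exp s ^ NG := by
          gcongr
          linarith [Real.add_one_le_exp s]
      _ = Real.exp (s * NG) := by rw [mul_comm, Real.exp_nat_mul]
      _ ≤ _ := Real.exp_le_exp.2 hsE
  have hpow : (2 : ℝ) ^ ((n : ℝ) / 2) = √(2 ^ n) := by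
    rw [Real.sqrt_eq_rpow, ← Real.rpow_natCast, ← Real.rpow_mul zero_le_two, mul_one_div]
  rw [PauliQEM.rmseBound, hpow, ← Real.sqrt_mul (by positivity)]
  refine Real.sqrt_le_sqrt (h.trans ?_)
  gcongr
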